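/- **The calculus $\lambda_{LAL}^{Reg,\mu}$.** Fix countable sets of variables $x$ and of region names $r$. Values and terms are $$V ::= x \mid \lambda x.M \mid r \mid () \mid \underline{n} \mid\ !V \mid \S V,$$ $$M ::= V \mid M_1M_2 \mid V_1\star V_2 \mid\ !M \mid \S M \mid \mathsf{let}\ !x=V\ \mathsf{in}\ M \mid \mathsf{let}\ \S x=V\ \mathsf{in}\ M \mid \mathsf{get}(r)\mid \mathsf{set}(r,V),$$ up to renaming of bound variables, where $n$ is an integer and $\star$ any binary operation on integers. The depth $d(M)$ is the maximal number of modal constructors $!,\S$ under which an occurrence of $M$ is nested, and $size(M)$ is the number of nodes of the syntax tree of $M$. Below, $\dagger$ stands for $!$ or $\S$. **Machine.** A configuration $\langle M,E,S\rangle$ consists of a term, an environment $E ::= \diamond\mid V\cdot E\mid M\odot E\mid\ !\cdot E\mid \S\cdot E$ and a store $S$, a finite multiset of assignments $r\leftarrow V$. The steps are $\langle \underline{n_1}\star \underline{n_2},E,S\rangle\to\langle \underline{n_1\star n_2},E,S\rangle$; $\langle\lambda x.M,V\cdot E,S\rangle\to\langle M[V/x],E,S\rangle$; $\langle MN,E,S\rangle\to\langle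 N,M\odot E,S\rangle$; $\langle V,M\odot E,S\rangle\to\langle M,V\cdot E,S\rangle$; $\langle\dagger M,E,S\rangle\to\langle M,\dagger\cdot E,S\rangle$ if $M$ is not a value; $\langle V,\dagger\cdot E,S\rangle\to\langle\dagger V,E,S\rangle$; $\langle\mathsf{let}\ \dagger x=\dagger V\ \mathsf{in}\ M,E,S\rangle\to\langle M[V/x],E,S\rangle$; $\langle\mathsf{get}(r),E,\{r\leftarrow V\}\uplus S\rangle\to\langle V,E,S\rangle$; $\langle\mathsf{set}(r,V),E,S\rangle\to\langle (),E,\{r\leftarrow V\}\uplus S\rangle$. A configuration to which no step applies is final. **Types.** $A,B::=X\mid \mathsf{Unit}\mid\mathsf N\mid A\multimap B\mid\ !A\mid\S A\mid\mu X.A\mid \mathsf{Reg}_rA$. A region context $R$ is a finite set of declarations $r:(\delta,A)$, $\delta\in\mathbb N$, for distinct regions. $R\vdash A$ means that every region name occurring in $A$ or in the types of $R$ is declared in $R$, and that every type $\mathsf{Reg}_rB$ occurring there has $B=A_r$, where $r:(\delta_r,A_r)\in R$; $R\vdash$ and $R\vdash\Gamma$ mean the same for, respectively, the types of $R$ alone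 and the types of $R$ and $\Gamma$. A variable context $\Gamma$ is a finite set of declarations $x:(u,A)$, with $u\in\{\lambda,!,\S\}$, for distinct variables. Judgments $R;\Gamma\vdash^\delta M:A$, $\delta\in\mathbb N$, are derived by the following rules, where $\Gamma,\Delta$ denotes the union of contexts without common variables and $-$ is the empty context: * if $R\vdash$: $R;-\vdash^\delta\underline n:\mathsf N$; $R;-\vdash^\delta():\mathsf{Unit}$; $R;x:(\lambda,A)\vdash^\delta x:A$; and $R;-\vdash^\delta r:\mathsf{Reg}_rA$ when $r:(\delta,A)\in R$; * from $R;\Gamma\vdash^\delta V_1:\mathsf N$ and $R;\Delta\vdash^\delta V_2:\mathsf N$ infer $R;\Gamma,\Delta\vdash^\delta V_1\star V_2:\mathsf N$; * contraction: from $R;\Gamma,x:(!,A),y:(!,A)\vdash^\delta M:B$ infer $R;\Gamma,z:(!,A)\vdash^\delta M[z/x,z/y]:B$; * weakening: from $R;\Gamma\vdash^\delta M:B$ and $R\vdash\Gamma,x:(u,A)$ infer $R;\Gamma,x:(u,A)\vdash^\delta M:B$; * from $R;\Gamma,x:(\lambda,A)\vdash^\delta M:B$ infer $R;\Gamma\vdash^\delta\lambda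 x.M:A\multimap B$; from $R;\Gamma\vdash^\delta M_1:A\multimap B$ and $R;\Delta\vdash^\delta M_2:A$ infer $R;\Gamma,\Delta\vdash^\delta M_1M_2:B$; * $!$-promotion, for a value $V$: from $R;x:(\lambda,A)\vdash^\delta V:B$ infer $R;x:(!,A)\vdash^{\delta+1}\,!V:\,!B$, and from $R;-\vdash^\delta V:B$ infer $R;-\vdash^{\delta+1}\,!V:\,!B$; * $\S$-promotion: from $R;\Gamma\vdash^\delta M:A$, where all usages in $\Gamma$ are $\lambda$, infer $R;\Gamma'\vdash^{\delta+1}\S M:\S A$, where $\Gamma'$ is $\Gamma$ with each usage replaced by $\S$ or by $!$; * from $R;\Gamma\vdash^\delta V:\dagger A$ and $R;\Delta,x:(\dagger,A)\vdash^\delta M:B$ infer $R;\Gamma,\Delta\vdash^\delta\mathsf{let}\ \dagger x=V\ \mathsf{in}\ M:B$; * from $R;-\vdash^\delta r:\mathsf{Reg}_rA$ infer $R;-\vdash^\delta\mathsf{get}(r):A$; if moreover $R;\Gamma\vdash^\delta V:A$, infer $R;\Gamma\vdash^\delta\mathsf{set}(r,V):\mathsf{Unit}$; * from $R;\Gamma\vdash^\delta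 M:\mu X.A$ infer $R;\Gamma\vdash^\delta M:A[\mu X.A/X]$, and conversely. A term $M$ is *well-typed* if $R;\Gamma\vdash^\delta M:A$ is derivable for some $R,\Gamma,\delta,A$ such that every type declared in $R$ has the form $\S B$, and for every type $\mu X.B$ occurring in $R$ or $\Gamma$ all occurrences of $X$ in $B$ are under a modality $!$ or $\S$. **Theorem (Polynomial termination).** There is a family of polynomials $\{P_d\}_{d\in\mathbb N}$ such that for every well-typed term $M$ the machine started from $\langle M,\diamond,\diamond\rangle$ (empty environment and empty store) terminates within $P_{d(M)}(size(M))$ steps: every run from this configuration has at most that many steps (whichever stored values are read), and so a final configuration is reached. -/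

import Mathlib

namespace LALReg

/-- Region names (a countable set). -/
abbrev Region : Type := ℕ

/-- The two modalities `!` (bang) and `§` (paragraph). -/
inductive Modality : Type
  | bang
  | para

/-! ## Types -/

/-- Types; the variable bound by `μ` is a de Bruijn index.
`mod .bang A` is `!A`, `mod .para A` is `§A`, `reg r A` is `Reg_r A`. -/
inductive Ty : Type
  | tvar (n : ℕ)
  | unit
  | num
  | arrow (A B : Ty)
  | mod (m : Modality) (A : Ty)
  | mu (A : Ty)
  | reg (r : Region) (A : Ty)

namespace Ty

/-- Lifting of a renaming of indices under one binder. -/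
def liftRen (ρ : ℕ → ℕ) : ℕ → ℕ
  | 0 => 0
  | n + 1 => ρ n + 1

/-- Renaming of type variables. -/
def rename : (ℕ → ℕ) → Ty → Ty
  | ρ, tvar n => tvar (ρ n)
  | _, unit => unit
  | _, num => num
  | ρ, arrow A B => arrow (rename ρ A) (rename ρ B)
  | ρ, mod m A => mod m (rename ρ A)
  | ρ, mu A => mu (rename (liftRen ρ) A)
  | ρ, reg r A => reg r (rename ρ A)

/-- Lifting of a substitution under one binder. -/
def liftSub (σ : ℕ → Ty) : ℕ → Ty
  | 0 => tvar 0
  | n + 1 => rename Nat.succ (σ n)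

/-- Capture-avoiding parallel substitution of types for type variables. -/
def subst : (ℕ → Ty) → Ty → Ty
  | σ, tvar n => σ n
  | _, unit => unit
  | _, num => num
  | σ, arrow A B => arrow (subst σ A) (subst σ B)
  | σ, mod m A => mod m (subst σ A)
  | σ, mu A => mu (subst (liftSub σ) A)
  | σ, reg r A => reg r (subst σ A)

/-- The substitution sending the variable `0` to `B` and lowering the others. -/
def single (B : Ty) : ℕ → Ty
  | 0 => B
  | n + 1 => tvar n

/-- The unfolding `A[μX.A/X]` of `μX.A`. -/
def unfold (A : Ty) : Ty := subst (single (mu A)) A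

/-- Every occurrence of the type variable `k` in the type is under a modality. -/
def GuardedVar : ℕ → Ty → Prop
  | k, tvar n => n ≠ k
  | _, unit => True
  | _, num => True
  | k, arrow A B => GuardedVar k A ∧ GuardedVar k B
  | _, mod _ _ => True
  | k, mu A => GuardedVar (k + 1) A
  | k, reg _ A => GuardedVar k A

/-- For every fixpoint `μX.A` occurring in the type, all occurrences of `X` in `A` are guarded
by a modality. -/
def FixGuarded : Ty → Prop
  | tvar _ => True
  | unit => True
  | num => True
  | arrow A B => FixGuarded A ∧ FixGuarded B
  | mod _ A => FixGuarded A
  | mu A => GuardedVar 0 A ∧ FixGuarded A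
  | reg _ A => FixGuarded A

end Ty

/-! ## Terms -/

/-- Terms up to renaming of bound variables (de Bruijn indices).
`arith op V W` is `V ⋆ W` for the binary operation `op`; `regc r` is the region constant `r`;
`mod m M` is `!M` or `§M`; `lett m V M` is `let m x = V in M`, binding one variable in `M`.
The restriction of some positions to values is part of the typing rules. -/
inductive Tm : Type
  | var (x : ℕ)
  | lam (M : Tm)
  | regc (r : Region)
  | unit
  | int (n : ℤ)
  | app (M N : Tm)
  | arith (op : ℤ → ℤ → ℤ) (V W : Tm)
  | mod (m : Modality) (M : Tm)
  | lett (m : Modality) (V M : Tm)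
  | get (r : Region)
  | set (r : Region) (V : Tm)

namespace Tm

/-- Values: `V ::= x | λx.M | r | () | n | !V | §V`. -/
inductive IsValue : Tm → Prop
  | var (x : ℕ) : IsValue (var x)
  | lam (M : Tm) : IsValue (lam M)
  | regc (r : Region) : IsValue (regc r)
  | unit : IsValue unit
  | int (n : ℤ) : IsValue (int n)
  | mod (m : Modality) {V : Tm} : IsValue V → IsValue (mod m V)

/-- Lifting of a renaming of indices under one binder. -/
def liftRen (ρ : ℕ → ℕ) : ℕ → ℕ
  | 0 => 0
  | n + 1 => ρ n + 1

/-- Renaming of free variables. -/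
def rename : (ℕ → ℕ) → Tm → Tm
  | ρ, var x => var (ρ x)
  | ρ, lam M => lam (rename (liftRen ρ) M)
  | _, regc r => regc r
  | _, unit => unit
  | _, int n => int n
  | ρ, app M N => app (rename ρ M) (rename ρ N)
  | ρ, arith op V W => arith op (rename ρ V) (rename ρ W)
  | ρ, mod m M => mod m (rename ρ M)
  | ρ, lett m V M => lett m (rename ρ V) (rename (liftRen ρ) M)
  | _, get r => get r
  | ρ, set r V => set r (rename ρ V)

/-- Lifting of a substitution under one binder. -/
def liftSub (σ : ℕ → Tm) : ℕ → Tm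
  | 0 => var 0
  | n + 1 => rename Nat.succ (σ n)

/-- Capture-avoiding parallel substitution. -/
def subst : (ℕ → Tm) → Tm → Tm
  | σ, var x => σ x
  | σ, lam M => lam (subst (liftSub σ) M)
  | _, regc r => regc r
  | _, unit => unit
  | _, int n => int n
  | σ, app M N => app (subst σ M) (subst σ N)
  | σ, arith op V W => arith op (subst σ V) (subst σ W)
  | σ, mod m M => mod m (subst σ M)
  | σ, lett m V M => lett m (subst σ V) (subst (liftSub σ) M)
  | _, get r => get r
  | σ, set r V => set r (subst σ V)

/-- The substitution sending the variable `0` to `V` and lowering the others. -/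
def single (V : Tm) : ℕ → Tm
  | 0 => V
  | n + 1 => var n

/-- `M[V/x]`, for the variable `x` bound by the innermost binder around `M`. -/
def inst (M V : Tm) : Tm := subst (single V) M

/-- The size of a term: the number of its occurrences (nodes of the syntax tree). -/
def size : Tm → ℕ
  | var _ => 1
  | lam M => size M + 1
  | regc _ => 1
  | unit => 1
  | int _ => 1
  | app M N => size M + size N + 1
  | arith _ V W => size V + size W + 1
  | mod _ M => size M + 1
  | lett _ V M => size V + size M + 1
  | get _ => 1
  | set _ V => size V + 1

/-- The depth of a term: the maximal number of nested modal constructors above an occurrence. -/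
def depth : Tm → ℕ
  | var _ => 0
  | lam M => depth M
  | regc _ => 0
  | unit => 0
  | int _ => 0
  | app M N => max (depth M) (depth N)
  | arith _ V W => max (depth V) (depth W)
  | mod _ M => depth M + 1
  | lett _ V M => max (depth V) (depth M)
  | get _ => 0
  | set _ V => depth V

end Tm

/-! ## The abstract machine -/

/-- Frames of an environment: `V ·` (`arg V`), `M ⊙` (`fn M`), and `! ·` or `§ ·` (`mod m`). -/
inductive Frame : Type
  | arg (V : Tm)
  | fn (M : Tm)
  | mod (m : Modality)

/-- Environments; `[]` is the empty frame `⋄`. -/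
abbrev Env : Type := List Frame

/-- Stores: finite multisets of region assignments `r ← V`. -/
abbrev Store : Type := Multiset (Region × Tm)

/-- Configurations `⟨M, E, S⟩`. -/
structure Conf : Type where
  term : Tm
  env : Env
  store : Store

/-- The initial configuration `⟨M, ⋄, ⋄⟩`: empty environment and empty store. -/
def Conf.init (M : Tm) : Conf := ⟨M, [], 0⟩

/-- One step of the machine. Reading a region consumes one of its values (any of them), and
writing adds a value. -/
inductive Step : Conf → Conf → Prop
  | arith (op : ℤ → ℤ → ℤ) (a b : ℤ) (E : Env) (S : Store) :
      Step ⟨.arith op (.int a) (.int b), E, S⟩ ⟨.int (op a b), E, S⟩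
  | beta (M V : Tm) (E : Env) (S : Store) : V.IsValue →
      Step ⟨.lam M, .arg V :: E, S⟩ ⟨M.inst V, E, S⟩
  | app (M N : Tm) (E : Env) (S : Store) :
      Step ⟨.app M N, E, S⟩ ⟨N, .fn M :: E, S⟩
  | swap (V M : Tm) (E : Env) (S : Store) : V.IsValue →
      Step ⟨V, .fn M :: E, S⟩ ⟨M, .arg V :: E, S⟩
  | enter (m : Modality) (M : Tm) (E : Env) (S : Store) : ¬ M.IsValue →
      Step ⟨.mod m M, E, S⟩ ⟨M, .mod m :: E, S⟩
  | leave (m : Modality) (V : Tm) (E : Env) (S : Store) : V.IsValue →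
      Step ⟨V, .mod m :: E, S⟩ ⟨.mod m V, E, S⟩
  | lett (m : Modality) (V M : Tm) (E : Env) (S : Store) : V.IsValue →
      Step ⟨.lett m (.mod m V) M, E, S⟩ ⟨M.inst V, E, S⟩
  | get (r : Region) (V : Tm) (E : Env) (S : Store) :
      Step ⟨.get r, E, (r, V) ::ₘ S⟩ ⟨V, E, S⟩
  | set (r : Region) (V : Tm) (E : Env) (S : Store) : V.IsValue →
      Step ⟨.set r V, E, S⟩ ⟨.unit, E, (r, V) ::ₘ S⟩

/-- `Steps n C C'`: the machine can go from `C` to `C'` in exactly `n` steps. -/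
inductive Steps : ℕ → Conf → Conf → Prop
  | refl (C : Conf) : Steps 0 C C
  | head {n : ℕ} {C C' C'' : Conf} : Step C C' → Steps n C' C'' → Steps (n + 1) C C''

/-- No rule of the machine applies. -/
def Conf.IsFinal (C : Conf) : Prop := ∀ C', ¬ Step C C'

/-- `C` terminates in at most `N` steps: whatever values are read from the store, no run from `C`
is longer than `N` steps, and some run ends in a final configuration. -/
def TerminatesWithin (C : Conf) (N : ℕ) : Prop :=
  (∀ (n : ℕ) (C' : Conf), Steps n C C' → n ≤ N) ∧
    ∃ (n : ℕ) (C' : Conf), Steps n C C' ∧ C'.IsFinal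

/-! ## The type system -/

/-- Usages `λ`, `§`, `!` of variables. -/
inductive Usage : Type
  | lam
  | mod (m : Modality)

/-- Variable contexts: partial maps from (free) variables to usages and types. Every context of
a derivable judgment is finite, because the typing rules only build finite ones. -/
abbrev Ctx : Type := ℕ → Option (Usage × Ty)

namespace Ctx

/-- The empty context. -/
def empty : Ctx := fun _ => none

/-- `Γ, x : (u, A)` for a variable `x` that is not in `Γ`. -/
def insert (Γ : Ctx) (x : ℕ) (u : Usage) (A : Ty) : Ctx := Function.update Γ x (some (u, A))

/-- The context `Γ, x : (u, A)` under a binder of `x`, which becomes the variable `0`. -/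
def cons (u : Usage) (A : Ty) (Γ : Ctx) : Ctx
  | 0 => some (u, A)
  | n + 1 => Γ n

/-- The two contexts have no variable in common. -/
def Disjoint (Γ Δ : Ctx) : Prop := ∀ x, Γ x = none ∨ Δ x = none

/-- `Γ, Δ` for disjoint contexts. -/
def union (Γ Δ : Ctx) : Ctx := fun x => (Γ x).or (Δ x)

/-- All variables of `Γ` have usage `λ`, and `Γ'` arises from `Γ` by giving each of them one
of the usages `§`, `!`. -/
def Promotes (Γ Γ' : Ctx) : Prop :=
  ∀ x, (Γ x = none ∧ Γ' x = none) ∨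
    ∃ (A : Ty) (m : Modality), Γ x = some (.lam, A) ∧ Γ' x = some (.mod m, A)

end Ctx

/-- Region contexts: `R r = some (δ, A)` means that `r : (δ, A)` is in `R`. -/
abbrev RegCtx : Type := Region → Option (ℕ × Ty)

/-- Each region name occurring in the type belongs to `R`, and each subexpression `Reg_r B` has
`B = A` where `r : (δ, A)` is in `R`. The number `k` counts the binders `μ` that have been
crossed: below them `A` is the type of `R` with its indices raised by `k`. -/
def RegOK (R : RegCtx) : ℕ → Ty → Prop
  | _, .tvar _ => True
  | _, .unit => True
  | _, .num => True
  | k, .arrow A B => RegOK R k A ∧ RegOK R k B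
  | k, .mod _ A => RegOK R k A
  | k, .mu A => RegOK R (k + 1) A
  | k, .reg r B =>
      (∃ (δ : ℕ) (A : Ty), R r = some (δ, A) ∧ B = A.rename (fun n => n + k)) ∧ RegOK R k B

/-- `R ⊢`. -/
def RegCtx.WF (R : RegCtx) : Prop := ∀ (r : Region) (δ : ℕ) (A : Ty), R r = some (δ, A) → RegOK R 0 A

/-- `R ⊢ A`. -/
def RegCtx.WFTy (R : RegCtx) (A : Ty) : Prop := R.WF ∧ RegOK R 0 A

/-- `R ⊢ Γ`. -/
def RegCtx.WFCtx (R : RegCtx) (Γ : Ctx) : Prop :=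
  R.WF ∧ ∀ (x : ℕ) (u : Usage) (A : Ty), Γ x = some (u, A) → R.WFTy A

/-- The renaming that sends `x` and `y` to `z`. -/
def contractRen (x y z : ℕ) : ℕ → ℕ := fun i => if i = x ∨ i = y then z else i

/-- The typing judgment `R; Γ ⊢^δ M : A`. All depth indices are natural numbers. -/
inductive HasType (R : RegCtx) : Ctx → ℕ → Tm → Ty → Prop
  | int (δ : ℕ) (n : ℤ) : R.WF → HasType R .empty δ (.int n) .num
  | arith {Γ Δ : Ctx} {δ : ℕ} {V W : Tm} (op : ℤ → ℤ → ℤ) : Γ.Disjoint Δ →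
      V.IsValue → W.IsValue → HasType R Γ δ V .num → HasType R Δ δ W .num →
      HasType R (Γ.union Δ) δ (.arith op V W) .num
  | var (δ x : ℕ) (A : Ty) : R.WF → HasType R (Ctx.empty.insert x .lam A) δ (.var x) A
  | unit (δ : ℕ) : R.WF → HasType R .empty δ .unit .unit
  | regc {δ : ℕ} {r : Region} {A : Ty} : R.WF → R r = some (δ, A) →
      HasType R .empty δ (.regc r) (.reg r A)
  | contr {Γ : Ctx} {δ : ℕ} {M : Tm} {A B : Ty} {x y z : ℕ} :
      Γ x = none → Γ y = none → Γ z = none → x ≠ y →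
      HasType R ((Γ.insert x (.mod .bang) A).insert y (.mod .bang) A) δ M B →
      HasType R (Γ.insert z (.mod .bang) A) δ (M.rename (contractRen x y z)) B
  | weak {Γ : Ctx} {δ : ℕ} {M : Tm} {A B : Ty} {x : ℕ} {u : Usage} :
      Γ x = none → HasType R Γ δ M B → R.WFCtx (Γ.insert x u A) →
      HasType R (Γ.insert x u A) δ M B
  | lam {Γ : Ctx} {δ : ℕ} {M : Tm} {A B : Ty} :
      HasType R (Γ.cons .lam A) δ M B → HasType R Γ δ (.lam M) (.arrow A B)
  | app {Γ Δ : Ctx} {δ : ℕ} {M N : Tm} {A B : Ty} : Γ.Disjoint Δ →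
      HasType R Γ δ M (.arrow A B) → HasType R Δ δ N A →
      HasType R (Γ.union Δ) δ (.app M N) B
  | bangProm {x δ : ℕ} {V : Tm} {A B : Ty} : V.IsValue →
      HasType R (Ctx.empty.insert x .lam A) δ V B →
      HasType R (Ctx.empty.insert x (.mod .bang) A) (δ + 1) (.mod .bang V) (.mod .bang B)
  | bangPromClosed {δ : ℕ} {V : Tm} {B : Ty} : V.IsValue →
      HasType R .empty δ V B →
      HasType R .empty (δ + 1) (.mod .bang V) (.mod .bang B)
  | paraProm {Γ Γ' : Ctx} {δ : ℕ} {M : Tm} {A : Ty} : Γ.Promotes Γ' →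
      HasType R Γ δ M A → HasType R Γ' (δ + 1) (.mod .para M) (.mod .para A)
  | lett {Γ Δ : Ctx} {δ : ℕ} {V M : Tm} {A B : Ty} (m : Modality) : Γ.Disjoint Δ →
      V.IsValue → HasType R Γ δ V (.mod m A) → HasType R (Δ.cons (.mod m) A) δ M B →
      HasType R (Γ.union Δ) δ (.lett m V M) B
  | get {δ : ℕ} {r : Region} {A : Ty} :
      HasType R .empty δ (.regc r) (.reg r A) → HasType R .empty δ (.get r) A
  | set {Γ : Ctx} {δ : ℕ} {r : Region} {V : Tm} {A : Ty} :
      HasType R .empty δ (.regc r) (.reg r A) → V.IsValue → HasType R Γ δ V A →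
      HasType R Γ δ (.set r V) .unit
  | unfold {Γ : Ctx} {δ : ℕ} {M : Tm} {A : Ty} :
      HasType R Γ δ M (.mu A) → HasType R Γ δ M A.unfold
  | fold {Γ : Ctx} {δ : ℕ} {M : Tm} {A : Ty} :
      HasType R Γ δ M A.unfold → HasType R Γ δ M (.mu A)

/-- `M` is well-typed: some `R; Γ ⊢^δ M : A` with `R` finite is derivable, all regions hold
values of types of the form `§B`, and all type fixpoints in `R` and `Γ` are guarded. -/
def WellTyped (M : Tm) : Prop :=
  ∃ (R : RegCtx) (Γ : Ctx) (δ : ℕ) (A : Ty),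
    {r : Region | R r ≠ none}.Finite ∧
    HasType R Γ δ M A ∧
    (∀ (r : Region) (δ' : ℕ) (B : Ty), R r = some (δ', B) → ∃ C : Ty, B = .mod .para C) ∧
    (∀ (r : Region) (δ' : ℕ) (B : Ty), R r = some (δ', B) → B.FixGuarded) ∧
    (∀ (x : ℕ) (u : Usage) (B : Ty), Γ x = some (u, B) → B.FixGuarded)

end LALReg

/-!
The number of steps is bounded by a weight that drops at every step. A closed box `!V` weighs
nothing, so that it can be read from the store, duplicated or discarded for free. An open box `!V`
weighs `box δ` times its content. When its free variable is filled in, this weight disappears, but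
the value `box δ * V.weight` that `maxBox` records for the box grows by no more than what is freed;
hence the potential `maxBox + weight` never increases, and stays below a constant `Z`.

A step `let !x = !V in M` copies `V` to places directly below one modal constructor. Copies below
`!` land in boxes; those below `§` become active and have to be paid for by the step. It can pay
`node δ` for each copy, and this is enough: `box δ * V.weight` is at most the potential, hence less
than `Z ≤ box δ * node δ`. With `node i = a ^ (2 ^ d - 2 ^ i)` and `box i = a ^ 2 ^ i`, where `d` is
the depth and `a` is six times the size of the term, the initial potential is at most
`Z = a ^ 2 ^ d`.
-/

namespace LALReg

namespace Tm

theorem size_pos (M : Tm) : 0 < M.size := by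
  cases M <;> exact Nat.succ_pos _

theorem isValue_mod {m : Modality} {M : Tm} : (mod m M).IsValue ↔ M.IsValue :=
  ⟨fun | .mod _ h => h, .mod m⟩

theorem isValue_subst {σ : ℕ → Tm} (hσ : ∀ x, (σ x).IsValue) (M : Tm) :
    (M.subst σ).IsValue ↔ M.IsValue := by
  induction M with
  | var x => exact iff_of_true (hσ x) (.var x)
  | lam M => exact iff_of_true (.lam _) (.lam M)
  | mod m M ih => simp only [subst, isValue_mod, ih]
  | regc | unit | int => rfl
  | app | arith | lett | get | set => exact iff_of_false nofun nofun

theorem liftRen_comp (ρ ρ' : ℕ → ℕ) : liftRen ρ' ∘ liftRen ρ = liftRen (ρ' ∘ ρ) := by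
  funext x
  cases x <;> rfl

theorem rename_rename (ρ ρ' : ℕ → ℕ) (M : Tm) :
    (M.rename ρ).rename ρ' = M.rename (ρ' ∘ ρ) := by
  induction M generalizing ρ ρ' <;> simp_all [rename, liftRen_comp]

theorem liftRen_id : liftRen id = id := by
  funext x
  cases x <;> rfl

theorem rename_id (M : Tm) : M.rename id = M := by
  induction M <;> simp_all [rename, liftRen_id]

theorem rename_eq_subst (ρ : ℕ → ℕ) (M : Tm) : M.rename ρ = M.subst fun x => var (ρ x) := by
  have lift (ρ : ℕ → ℕ) : (liftSub fun x => var (ρ x)) = fun x => var (liftRen ρ x) := by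
    funext x
    cases x <;> rfl
  induction M generalizing ρ <;> simp_all [rename, subst]

theorem isValue_rename (ρ : ℕ → ℕ) (M : Tm) : (M.rename ρ).IsValue ↔ M.IsValue :=
  rename_eq_subst ρ M ▸ isValue_subst (fun _ => .var _) M

/-- The occurrences of free variables of `λx.M`, given those of `M`. -/
def lowerOccs (l : List (List Modality × ℕ)) : List (List Modality × ℕ) :=
  l.filterMap fun
    | (_, 0) => none
    | (p, x + 1) => some (p, x)

@[simp] theorem lowerOccs_cons_zero (p : List Modality) (l : List (List Modality × ℕ)) :
    lowerOccs ((p, 0) :: l) = lowerOccs l := rfl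

@[simp] theorem lowerOccs_cons_succ (p : List Modality) (x : ℕ) (l : List (List Modality × ℕ)) :
    lowerOccs ((p, x + 1) :: l) = (p, x) :: lowerOccs l := rfl

@[simp] theorem lowerOccs_append (l l' : List (List Modality × ℕ)) :
    lowerOccs (l ++ l') = lowerOccs l ++ lowerOccs l' := List.filterMap_append

/-- The occurrences of free variables, from left to right: `(p, x)` is an occurrence of `x` under
the modal constructors `p`, the outermost of which comes first. -/
def occs : Tm → List (List Modality × ℕ)
  | var x => [([], x)]
  | lam M => lowerOccs M.occs
  | regc _ => []
  | unit => []
  | int _ => []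
  | app M N => M.occs ++ N.occs
  | arith _ V W => V.occs ++ W.occs
  | mod m M => M.occs.map (Prod.map (m :: ·) id)
  | lett _ V M => V.occs ++ lowerOccs M.occs
  | get _ => []
  | set _ V => V.occs

/-- The occurrences of the variable `x`, each given by the modal constructors above it. -/
def paths (x : ℕ) (M : Tm) : List (List Modality) :=
  (M.occs.filter fun o => o.2 = x).map Prod.fst

theorem mem_paths {p : List Modality} {x : ℕ} {M : Tm} : p ∈ M.paths x ↔ (p, x) ∈ M.occs := by
  simp [paths]

theorem map_fst_filter_lowerOccs (x : ℕ) (l : List (List Modality × ℕ)) :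
    ((lowerOccs l).filter fun o => o.2 = x).map Prod.fst =
      (l.filter fun o => o.2 = x + 1).map Prod.fst := by
  induction l with
  | nil => rfl
  | cons o l ih =>
    obtain ⟨p, _ | y⟩ := o
    · simpa using ih
    · by_cases h : y = x <;> simpa [h] using ih

section paths

variable (x : ℕ) (M N : Tm)

@[simp] theorem paths_var (y : ℕ) : (var y).paths x = if y = x then [[]] else [] := by
  by_cases h : y = x <;> simp [paths, occs, h]

@[simp] theorem paths_lam : (lam M).paths x = M.paths (x + 1) := map_fst_filter_lowerOccs x _

@[simp] theorem paths_app : (app M N).paths x = M.paths x ++ N.paths x := by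
  simp [paths, occs]

@[simp] theorem paths_arith (op : ℤ → ℤ → ℤ) :
    (arith op M N).paths x = M.paths x ++ N.paths x := by
  simp [paths, occs]

@[simp] theorem paths_mod (m : Modality) : (mod m M).paths x = (M.paths x).map (m :: ·) := by
  simp [paths, occs, List.filter_map, Function.comp_def]

@[simp] theorem paths_lett (m : Modality) :
    (lett m N M).paths x = N.paths x ++ M.paths (x + 1) := by
  simp only [paths, occs, List.filter_append, List.map_append, map_fst_filter_lowerOccs]

@[simp] theorem paths_set (r : Region) : (set r M).paths x = M.paths x := rfl
@[simp] theorem paths_get (r : Region) : (get r).paths x = [] := rfl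

end paths

theorem length_occs_eq (M : Tm) :
    M.occs.length = (M.paths 0).length + (lowerOccs M.occs).length := by
  rw [paths]
  induction M.occs with
  | nil => rfl
  | cons o l ih =>
    obtain ⟨p, _ | x⟩ := o
    · simpa [add_right_comm _ 1] using ih
    · simpa [← add_assoc] using ih

theorem occs_rename (ρ : ℕ → ℕ) (M : Tm) :
    (M.rename ρ).occs = M.occs.map (Prod.map id ρ) := by
  have lift (ρ : ℕ → ℕ) (l : List (List Modality × ℕ)) :
      lowerOccs (l.map (Prod.map id (liftRen ρ))) = (lowerOccs l).map (Prod.map id ρ) := by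
    induction l with
    | nil => rfl
    | cons o l ih => obtain ⟨p, _ | x⟩ := o <;> simpa [liftRen] using ih
  induction M generalizing ρ <;> simp_all [occs, rename]

theorem paths_rename {ρ : ℕ → ℕ} {x x' : ℕ} (h : ∀ y, ρ y = x ↔ y = x') (M : Tm) :
    (M.rename ρ).paths x = M.paths x' := by
  simp [paths, occs_rename, List.filter_map, Function.comp_def, h]

theorem mem_paths_rename {ρ : ℕ → ℕ} {p : List Modality} {x : ℕ} {M : Tm} :
    p ∈ (M.rename ρ).paths x ↔ ∃ y, ρ y = x ∧ p ∈ M.paths y := by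
  simp only [mem_paths, occs_rename, List.mem_map, Prod.exists, Prod.map_apply, id_eq,
    Prod.mk.injEq]
  aesop

theorem paths_rename_liftRen (ρ : ℕ → ℕ) (M : Tm) :
    (M.rename (liftRen ρ)).paths 0 = M.paths 0 :=
  paths_rename (fun y => by cases y <;> simp [liftRen]) M

theorem occs_subst (σ : ℕ → Tm) (M : Tm) :
    (M.subst σ).occs = M.occs.flatMap fun o => (σ o.2).occs.map (Prod.map (o.1 ++ ·) id) := by
  have lift_succ (σ : ℕ → Tm) (p : List Modality) (x : ℕ) :
      lowerOccs ((liftSub σ (x + 1)).occs.map (Prod.map (p ++ ·) id)) =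
        (σ x).occs.map (Prod.map (p ++ ·) id) := by
    rw [liftSub, occs_rename]
    induction (σ x).occs with
    | nil => rfl
    | cons o l ih => exact congrArg (_ :: ·) ih
  have lift (σ : ℕ → Tm) (l : List (List Modality × ℕ)) :
      lowerOccs (l.flatMap fun o => (liftSub σ o.2).occs.map (Prod.map (o.1 ++ ·) id)) =
        (lowerOccs l).flatMap fun o => (σ o.2).occs.map (Prod.map (o.1 ++ ·) id) := by
    induction l with
    | nil => rfl
    | cons o l ih =>
      rw [List.flatMap_cons, lowerOccs_append, ih]
      obtain ⟨p, _ | x⟩ := o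
      · rfl
      · rw [lift_succ, lowerOccs_cons_succ, List.flatMap_cons]
  induction M generalizing σ with
  | var x =>
    simp only [occs, subst, List.flatMap_singleton]
    exact (List.map_id _).symm
  | mod m M ih =>
    simp only [occs, subst, ih, List.map_flatMap, List.flatMap_map, List.map_map]
    rfl
  | _ => simp_all [occs, subst]

theorem paths_subst (x : ℕ) (σ : ℕ → Tm) (M : Tm) :
    (M.subst σ).paths x = M.occs.flatMap fun o => ((σ o.2).paths x).map (o.1 ++ ·) := by
  simp [paths, occs_subst, List.filter_flatMap, List.map_flatMap, List.filter_map,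
    Function.comp_def]

theorem paths_subst_liftSub (σ : ℕ → Tm) (M : Tm) :
    (M.subst (liftSub σ)).paths 0 = M.paths 0 := by
  rw [paths_subst, paths]
  induction M.occs with
  | nil => rfl
  | cons o l ih =>
    obtain ⟨p, _ | x⟩ := o
    · simpa [liftSub] using ih
    · have : ((σ x).rename Nat.succ).paths 0 = [] := by
        simp [List.eq_nil_iff_forall_not_mem, mem_paths_rename]
      simpa [liftSub, this] using ih

end Tm

/-- The restriction that a usage puts on the occurrences of a variable, given as in `Tm.paths`:
usage `λ` allows at most one, under no modal constructor, `§` allows at most one, directly under a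
`§`, and `!` allows any number, each under exactly one modal constructor. -/
def Usage.Allows : Usage → List (List Modality) → Prop
  | .lam, ps => ps.Sublist [[]]
  | .mod .para, ps => ps.Sublist [[.para]]
  | .mod .bang, ps => ∀ p ∈ ps, p.length = 1

namespace Tm

/-- What typing says about a term at level `δ` and its machine runs preserve: bound variables occur
as their usages allow, a box `!V` holds a value with at most one free variable occurrence, and the
region `r` is only used at level `L r`, where each modal constructor raises the level by one. -/
def Stratified (L : Region → ℕ) : ℕ → Tm → Prop
  | _, var _ => True
  | δ, lam M => Usage.lam.Allows (M.paths 0) ∧ Stratified L δ M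
  | δ, regc r => L r = δ
  | _, unit => True
  | _, int _ => True
  | δ, app M N => Stratified L δ M ∧ Stratified L δ N
  | δ, arith _ V W => Stratified L δ V ∧ Stratified L δ W
  | δ, mod .para M => Stratified L (δ + 1) M
  | δ, mod .bang V => V.IsValue ∧ V.occs.length ≤ 1 ∧ Stratified L (δ + 1) V
  | δ, lett m V M => (Usage.mod m).Allows (M.paths 0) ∧ Stratified L δ V ∧ Stratified L δ M
  | δ, get r => L r = δ
  | δ, set r V => L r = δ ∧ Stratified L δ V

/-- `M` contains an occurrence of one of the variables bound by the `k` innermost binders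
around it. -/
def IsOpen (k : ℕ) (M : Tm) : Prop := ∃ o ∈ M.occs, o.2 < k

end Tm

/-- The coefficients of the weight of a term: at level `δ`, `node δ` pays for a machine step, and
an open box is worth `box δ` times its content. -/
structure Weights : Type where
  node : ℕ → ℕ
  box : ℕ → ℕ

namespace Tm

variable (w : Weights)

open Classical in
/-- The weight of a term at level `δ` below `k` binders. Closed boxes weigh nothing, so that they
can be duplicated and discarded for free; an open box is charged for before it gets closed.
In `app` the summand `3 * node` pays for pushing the function, swapping it with the argument, and
the call; the `2 * node` of `§M` pays for evaluating `M` below `§`; `lett` pays one `node` for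
itself, and one for each copy that it makes. -/
noncomputable def weight : ℕ → ℕ → Tm → ℕ
  | _, _, var _ => 0
  | δ, k, lam M => weight δ (k + 1) M
  | _, _, regc _ => 0
  | _, _, unit => 0
  | _, _, int _ => 0
  | δ, k, app M N => weight δ k M + weight δ k N + 3 * w.node δ
  | δ, k, arith _ V W => weight δ k V + weight δ k W + w.node δ
  | δ, k, mod .para M => weight (δ + 1) k M + if M.IsValue then 0 else 2 * w.node δ
  | δ, k, mod .bang V => if V.IsOpen k then w.box δ * weight (δ + 1) k V else 0
  | δ, k, lett _ V M =>
      weight δ k V + weight δ (k + 1) M + (1 + (M.paths 0).length) * w.node δ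
  | δ, _, get _ => w.node δ
  | δ, k, set _ V => weight δ k V + w.node δ

/-- The maximum of `box δ' * V.weight` over the boxes `!V` in a term at level `δ` below `k` binders,
where `δ'` is the level of the box. Unlike `weight`, it takes closed boxes into account. -/
noncomputable def maxBox : ℕ → ℕ → Tm → ℕ
  | _, _, var _ => 0
  | δ, k, lam M => maxBox δ (k + 1) M
  | _, _, regc _ => 0
  | _, _, unit => 0
  | _, _, int _ => 0
  | δ, k, app M N => max (maxBox δ k M) (maxBox δ k N)
  | δ, k, arith _ V W => max (maxBox δ k V) (maxBox δ k W)
  | δ, k, mod .para M => maxBox (δ + 1) k M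
  | δ, k, mod .bang V => max (w.box δ * V.weight w (δ + 1) k) (maxBox (δ + 1) k V)
  | δ, k, lett _ V M => max (maxBox δ k V) (maxBox δ (k + 1) M)
  | _, _, get _ => 0
  | δ, k, set _ V => maxBox δ k V

section rename

variable {w}

theorem liftRen_lt_succ_iff {ρ : ℕ → ℕ} {k k' : ℕ} (h : ∀ x, ρ x < k ↔ x < k') (x : ℕ) :
    liftRen ρ x < k + 1 ↔ x < k' + 1 := by
  cases x <;> simp [liftRen, h]

theorem isOpen_rename {ρ : ℕ → ℕ} {k k' : ℕ} (h : ∀ x, ρ x < k ↔ x < k') (M : Tm) :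
    (M.rename ρ).IsOpen k ↔ M.IsOpen k' := by
  simp [IsOpen, occs_rename, h]

theorem weight_rename {ρ : ℕ → ℕ} {k k' : ℕ} (h : ∀ x, ρ x < k ↔ x < k') (δ : ℕ) (M : Tm) :
    (M.rename ρ).weight w δ k = M.weight w δ k' := by
  induction M generalizing ρ δ k k' with
  | lam _ ih => exact ih (liftRen_lt_succ_iff h) δ
  | mod m M ih =>
    cases m with
    | bang => rw [rename, weight, weight, ih h, isOpen_rename h]
    | para => rw [rename, weight, weight, ih h, isValue_rename]
  | lett m V M ih₁ ih₂ =>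
    simp only [rename, weight, ih₁ h, ih₂ (liftRen_lt_succ_iff h), paths_rename_liftRen]
  | app M N ih₁ ih₂ | arith _ M N ih₁ ih₂ => simp only [rename, weight, ih₁ h, ih₂ h]
  | set _ V ih => simp only [rename, weight, ih h]
  | _ => rfl

theorem maxBox_rename {ρ : ℕ → ℕ} {k k' : ℕ} (h : ∀ x, ρ x < k ↔ x < k') (δ : ℕ) (M : Tm) :
    (M.rename ρ).maxBox w δ k = M.maxBox w δ k' := by
  induction M generalizing ρ δ k k' with
  | lam _ ih => exact ih (liftRen_lt_succ_iff h) δ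
  | mod m M ih => cases m <;> simp only [rename, maxBox, ih h, weight_rename h]
  | lett m V M ih₁ ih₂ => simp only [rename, maxBox, ih₁ h, ih₂ (liftRen_lt_succ_iff h)]
  | app M N ih₁ ih₂ | arith _ M N ih₁ ih₂ => simp only [rename, maxBox, ih₁ h, ih₂ h]
  | set _ V ih => simp only [rename, maxBox, ih h]
  | _ => rfl

theorem Stratified.rename {L : Region → ℕ} {δ : ℕ} {M : Tm} (h : M.Stratified L δ) (ρ : ℕ → ℕ) :
    (M.rename ρ).Stratified L δ := by
  induction M generalizing ρ δ with
  | lam M ih => exact ⟨(paths_rename_liftRen ρ M).symm ▸ h.1, ih h.2 _⟩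
  | lett m V M ih₁ ih₂ =>
    exact ⟨(paths_rename_liftRen ρ M).symm ▸ h.1, ih₁ h.2.1 _, ih₂ h.2.2 _⟩
  | mod m M ih =>
    cases m with
    | para => exact ih (δ := δ + 1) h ρ
    | bang =>
      refine ⟨(isValue_rename ρ M).2 h.1, ?_, ih h.2.2 ρ⟩
      rw [occs_rename, List.length_map]
      exact h.2.1
  | app M N ih₁ ih₂ | arith _ M N ih₁ ih₂ => exact ⟨ih₁ h.1 _, ih₂ h.2 _⟩
  | set _ V ih => exact ⟨h.1, ih h.2 _⟩
  | var | regc | unit | int | get => exact h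

end rename

/-- The substitution `single V`, carried below `k` binders. -/
def singleAt (V : Tm) : ℕ → ℕ → Tm
  | 0 => single V
  | k + 1 => liftSub (singleAt V k)

theorem singleAt_self (V : Tm) (k : ℕ) : V.singleAt k k = V.rename (· + k) := by
  induction k with
  | zero => exact (rename_id V).symm
  | succ k ih => rw [singleAt, liftSub, ih, rename_rename]; rfl

theorem singleAt_of_ne (V : Tm) {k x : ℕ} (h : x ≠ k) :
    V.singleAt k x = var (if x < k then x else x - 1) := by
  induction k generalizing x with
  | zero => cases x with
    | zero => exact absurd rfl h
    | succ x => rfl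
  | succ k ih => cases x with
    | zero => rfl
    | succ x =>
      have := ih (x := x) (by omega)
      simp only [singleAt, liftSub, this, rename]
      congr 1
      split_ifs <;> omega

theorem isValue_singleAt {V : Tm} (hV : V.IsValue) (k x : ℕ) : (V.singleAt k x).IsValue := by
  by_cases h : x = k
  · rw [h, singleAt_self]
    exact (isValue_rename _ V).2 hV
  · rw [singleAt_of_ne V h]
    exact .var _

theorem Stratified.singleAt {L : Region → ℕ} {δ k x : ℕ} {V : Tm}
    (h : x = k → V.Stratified L δ) : (V.singleAt k x).Stratified L δ := by
  by_cases hx : x = k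
  · rw [hx, singleAt_self]
    exact (h hx).rename _
  · rw [singleAt_of_ne V hx]
    trivial

theorem length_occs_subst_singleAt_le {k : ℕ} {V M : Tm} (hM : M.occs.length ≤ 1)
    (hV : ∀ p ∈ M.paths k, V.occs.length ≤ 1) : (M.subst (V.singleAt k)).occs.length ≤ 1 := by
  rw [occs_subst]
  match h : M.occs with
  | [] => exact Nat.zero_le 1
  | _ :: _ :: _ => simp [h] at hM
  | [(p, x)] =>
    rw [List.flatMap_singleton, List.length_map]
    by_cases hx : x = k
    · rw [hx, singleAt_self, occs_rename, List.length_map]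
      exact hV p (mem_paths.2 (by simp [h, hx]))
    · rw [singleAt_of_ne V hx]
      exact le_rfl

theorem isOpen_subst_singleAt (V M : Tm) (k : ℕ) :
    (M.subst (V.singleAt k)).IsOpen k ↔ M.IsOpen k := by
  have (x : ℕ) : (V.singleAt k x).IsOpen k ↔ x < k := by
    obtain rfl | h := eq_or_ne x k
    · simp [IsOpen, singleAt_self, occs_rename]
    · simp only [IsOpen, singleAt_of_ne V h, occs, List.mem_singleton, exists_eq_left]
      split_ifs <;> omega
  rw [IsOpen, IsOpen, occs_subst]
  simp only [IsOpen] at this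
  constructor
  · rintro ⟨o', ho', hk⟩
    obtain ⟨o, ho, h⟩ := List.mem_flatMap.1 ho'
    obtain ⟨o'', ho'', rfl⟩ := List.mem_map.1 h
    exact ⟨o, ho, (this o.2).1 ⟨o'', ho'', hk⟩⟩
  · rintro ⟨o, ho, hk⟩
    obtain ⟨o', ho', hk'⟩ := (this o.2).2 hk
    exact ⟨_, List.mem_flatMap.2 ⟨o, ho, List.mem_map_of_mem ho'⟩, hk'⟩

theorem paths_eq_nil_of_isOpen {M : Tm} (hM : M.occs.length ≤ 1) {k : ℕ} (h : M.IsOpen k) :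
    M.paths k = [] := by
  obtain ⟨o, ho, hk⟩ := h
  obtain ⟨o', ho'⟩ := List.length_eq_one_iff.1 (le_antisymm hM (List.length_pos_of_mem ho))
  obtain rfl : o = o' := by simpa [ho'] using ho
  simp [paths, ho', hk.ne]

theorem IsOpen.mono {k k' : ℕ} (hk : k ≤ k') {M : Tm} (h : M.IsOpen k) : M.IsOpen k' :=
  h.imp fun _ ho => ⟨ho.1, ho.2.trans_le hk⟩

theorem Stratified.subst {L : Region → ℕ} {δ l k : ℕ} {V M : Tm} (hV : V.IsValue)
    (hVs : V.Stratified L l) (hM : M.Stratified L δ)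
    (hp : ∀ p ∈ M.paths k, δ + p.length = l ∧ (.bang ∈ p → V.occs.length ≤ 1)) :
    (M.subst (V.singleAt k)).Stratified L δ := by
  induction M generalizing δ k with
  | var x =>
    refine Stratified.singleAt fun hx => ?_
    obtain rfl : δ = l := by simpa [hx] using hp
    exact hVs
  | lam M ih =>
    rw [paths_lam] at hp
    exact ⟨(paths_subst_liftSub _ M).symm ▸ hM.1, ih hM.2 hp⟩
  | lett m W M ih₁ ih₂ =>
    rw [paths_lett, List.forall_mem_append] at hp
    exact ⟨(paths_subst_liftSub _ M).symm ▸ hM.1, ih₁ hM.2.1 hp.1, ih₂ hM.2.2 hp.2⟩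
  | app M N ih₁ ih₂ | arith _ M N ih₁ ih₂ =>
    simp only [paths_app, paths_arith, List.forall_mem_append] at hp
    exact ⟨ih₁ hM.1 hp.1, ih₂ hM.2 hp.2⟩
  | set r W ih => exact ⟨hM.1, ih hM.2 hp⟩
  | mod m M ih =>
    rw [paths_mod, List.forall_mem_map] at hp
    have hp' : ∀ p ∈ M.paths k, δ + 1 + p.length = l ∧ (.bang ∈ p → V.occs.length ≤ 1) :=
      fun p h => ⟨(Nat.add_right_comm δ 1 _).trans (hp p h).1,
        fun hb => (hp p h).2 (List.mem_cons_of_mem _ hb)⟩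
    cases m with
    | para => exact ih (δ := δ + 1) hM hp'
    | bang =>
      refine ⟨(isValue_subst (isValue_singleAt hV k) M).2 hM.1, ?_, ih hM.2.2 hp'⟩
      exact length_occs_subst_singleAt_le hM.2.1 fun p h => (hp p h).2 List.mem_cons_self
  | regc | unit | int | get => exact hM

theorem weight_subst_le (w : Weights) {L : Region → ℕ} {δ l k : ℕ} {V M : Tm} (hV : V.IsValue)
    (hM : M.Stratified L δ) (hp : ∀ p ∈ M.paths k, δ + p.length = l) :
    (M.subst (V.singleAt k)).weight w δ k ≤
      M.weight w δ (k + 1) + (M.paths k).length * V.weight w l 0 := by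
  induction M generalizing δ k with
  | var x =>
    obtain rfl | h := eq_or_ne x k
    · obtain rfl : δ = l := by simpa using hp
      have := weight_rename (w := w) (ρ := (· + x)) (k := x) (k' := 0) (by simp) δ V
      simp [subst, singleAt_self, this]
    · simp [subst, singleAt_of_ne V h, weight]
  | lam M ih =>
    rw [paths_lam] at hp ⊢
    exact ih hM.2 hp
  | lett m W M ih₁ ih₂ =>
    rw [paths_lett, List.forall_mem_append] at hp
    have h₁ := ih₁ hM.2.1 hp.1
    have h₂ := ih₂ hM.2.2 hp.2
    rw [paths_lett, List.length_append, add_mul]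
    rw [singleAt] at h₂
    simp only [subst, weight, paths_subst_liftSub]
    omega
  | app M N ih₁ ih₂ | arith _ M N ih₁ ih₂ =>
    simp only [paths_app, paths_arith, List.forall_mem_append] at hp
    have h₁ := ih₁ hM.1 hp.1
    have h₂ := ih₂ hM.2 hp.2
    simp only [subst, weight, paths_app, paths_arith, List.length_append, add_mul]
    omega
  | set r W ih =>
    have h := ih hM.2 hp
    simp only [subst, weight, paths_set]
    omega
  | mod m M ih =>
    rw [paths_mod, List.forall_mem_map] at hp
    have hp' : ∀ p ∈ M.paths k, δ + 1 + p.length = l :=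
      fun p h => (Nat.add_right_comm δ 1 _).trans (hp p h)
    rw [paths_mod, List.length_map, subst]
    cases m with
    | para =>
      have h := ih (δ := δ + 1) hM hp'
      rw [weight, weight, isValue_subst (isValue_singleAt hV k)]
      omega
    | bang =>
      rw [weight, isOpen_subst_singleAt]
      split_ifs with h
      · have h' := ih hM.2.2 hp'
        rw [paths_eq_nil_of_isOpen hM.2.1 h] at h' ⊢
        rw [weight, if_pos (h.mono k.le_succ)]
        simpa using Nat.mul_le_mul_left _ h'
      · exact Nat.zero_le _
  | regc | unit | int | get => exact Nat.le_add_right _ _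

theorem weight_subst_le_of_length_paths_le_one (w : Weights) {L : Region → ℕ} {δ l k : ℕ}
    {V M : Tm} (hV : V.IsValue) (hM : M.Stratified L δ) (hp : ∀ p ∈ M.paths k, δ + p.length = l)
    (hk : (M.paths k).length ≤ 1) :
    (M.subst (V.singleAt k)).weight w δ k ≤ M.weight w δ (k + 1) + V.weight w l 0 :=
  (weight_subst_le w hV hM hp).trans <|
    Nat.add_le_add_left ((Nat.mul_le_mul_right _ hk).trans_eq (one_mul _)) _

theorem maxBox_subst_le (w : Weights) {L : Region → ℕ} {δ l k : ℕ} {V M : Tm} (hV : V.IsValue)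
    (hM : M.Stratified L δ) (hp : ∀ p ∈ M.paths k, δ + p.length = l ∧ .bang ∉ p) :
    (M.subst (V.singleAt k)).maxBox w δ k ≤ max (M.maxBox w δ (k + 1)) (V.maxBox w l 0) := by
  induction M generalizing δ k with
  | var x =>
    obtain rfl | h := eq_or_ne x k
    · obtain rfl : δ = l := by simpa using hp
      have := maxBox_rename (w := w) (ρ := (· + x)) (k := x) (k' := 0) (by simp) δ V
      simp [subst, singleAt_self, this]
    · simp [subst, singleAt_of_ne V h, maxBox]
  | lam M ih =>
    rw [paths_lam] at hp
    exact ih hM.2 hp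
  | lett m W M ih₁ ih₂ =>
    rw [paths_lett, List.forall_mem_append] at hp
    have h₁ := ih₁ hM.2.1 hp.1
    have h₂ := ih₂ hM.2.2 hp.2
    rw [singleAt] at h₂
    simp only [subst, maxBox]
    omega
  | app M N ih₁ ih₂ | arith _ M N ih₁ ih₂ =>
    simp only [paths_app, paths_arith, List.forall_mem_append] at hp
    have h₁ := ih₁ hM.1 hp.1
    have h₂ := ih₂ hM.2 hp.2
    simp only [subst, maxBox]
    omega
  | set r W ih => exact ih hM.2 hp
  | mod m M ih =>
    rw [paths_mod, List.forall_mem_map] at hp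
    have hp' : ∀ p ∈ M.paths k, δ + 1 + p.length = l ∧ .bang ∉ p :=
      fun p h => ⟨(Nat.add_right_comm δ 1 _).trans (hp p h).1,
        fun hb => (hp p h).2 (List.mem_cons_of_mem _ hb)⟩
    cases m with
    | para => exact ih (δ := δ + 1) hM hp'
    | bang =>
      have hnil : M.paths k = [] :=
        List.eq_nil_iff_forall_not_mem.2 fun p h => (hp p h).2 List.mem_cons_self
      have hbox := weight_subst_le w hV hM.2.2 fun p h => (hp' p h).1
      rw [hnil, List.length_nil, zero_mul, add_zero] at hbox
      have := ih hM.2.2 hp'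
      have := Nat.mul_le_mul_left (w.box δ) hbox
      simp only [subst, maxBox]
      omega
  | regc | unit | int | get => exact Nat.zero_le _

theorem maxBox_add_weight_subst_box_le (w : Weights) {L : Region → ℕ} {δ k B : ℕ} {V M : Tm}
    (hV : V.IsValue) (hM : (mod .bang M).Stratified L δ)
    (hp : ∀ p ∈ M.paths k, p = []) (hk : [] ∈ M.paths k)
    (hMB : (mod .bang M).maxBox w δ (k + 1) ≤ B) (hVB : (mod .bang V).maxBox w δ 0 ≤ B) :
    ((mod .bang M).subst (V.singleAt k)).maxBox w δ k +
        ((mod .bang M).subst (V.singleAt k)).weight w δ k ≤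
      B + (mod .bang M).weight w δ (k + 1) := by
  obtain ⟨-, hocc, hMs⟩ := hM
  rw [maxBox, max_le_iff] at hMB hVB
  have hopen : M.IsOpen (k + 1) := ⟨_, mem_paths.1 hk, k.lt_succ_self⟩
  have hclosed : ¬ M.IsOpen k := fun h => by simp [paths_eq_nil_of_isOpen hocc h] at hk
  have hlen : (M.paths k).length ≤ 1 :=
    (List.length_map _).trans_le ((List.length_filter_le _ _).trans hocc)
  have hmax := maxBox_subst_le (l := δ + 1) (k := k) w hV hMs fun p h => by simp [hp p h]
  have hbox := Nat.mul_le_mul_left (w.box δ) <|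
    weight_subst_le_of_length_paths_le_one (l := δ + 1) w hV hMs (fun p h => by simp [hp p h]) hlen
  rw [mul_add] at hbox
  rw [subst, maxBox, weight, weight, isOpen_subst_singleAt, if_neg hclosed, if_pos hopen]
  omega

theorem maxBox_add_weight_subst_le (w : Weights) {L : Region → ℕ} {δ k B : ℕ} {V M : Tm}
    (hV : V.IsValue) (hM : M.Stratified L δ) (hp : ∀ p ∈ M.paths k, p.length = 1)
    (hMB : M.maxBox w δ (k + 1) ≤ B) (hVB : (mod .bang V).maxBox w δ 0 ≤ B) :
    (M.subst (V.singleAt k)).maxBox w δ k + (M.subst (V.singleAt k)).weight w δ k ≤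
      B + (M.weight w δ (k + 1) + (M.paths k).length * V.weight w (δ + 1) 0) := by
  have weight_le {M : Tm} {k : ℕ} (hM : M.Stratified L δ) (hp : ∀ p ∈ M.paths k, p.length = 1) :=
    weight_subst_le w hV hM fun p h => congrArg (δ + ·) (hp p h)
  induction M generalizing k with
  | var x =>
    have hx : x ≠ k := fun h => by simp [h] at hp
    simp [subst, singleAt_of_ne V hx, maxBox, weight]
  | lam M ih =>
    rw [paths_lam] at hp ⊢
    exact ih hM.2 hp hMB
  | lett m W M ih₁ ih₂ =>
    rw [paths_lett, List.forall_mem_append] at hp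
    rw [maxBox, max_le_iff] at hMB
    have h₁ := ih₁ hM.2.1 hp.1 hMB.1
    have h₂ := ih₂ hM.2.2 hp.2 hMB.2
    have h₁' := weight_le hM.2.1 hp.1
    have h₂' := weight_le hM.2.2 hp.2
    rw [paths_lett, List.length_append, add_mul]
    rw [singleAt] at h₂ h₂'
    simp only [subst, maxBox, weight, paths_subst_liftSub]
    omega
  | app M N ih₁ ih₂ | arith _ M N ih₁ ih₂ =>
    simp only [paths_app, paths_arith, List.forall_mem_append] at hp
    simp only [maxBox, max_le_iff] at hMB
    have h₁ := ih₁ hM.1 hp.1 hMB.1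
    have h₂ := ih₂ hM.2 hp.2 hMB.2
    have h₁' := weight_le hM.1 hp.1
    have h₂' := weight_le hM.2 hp.2
    simp only [subst, maxBox, weight, paths_app, paths_arith, List.length_append, add_mul]
    omega
  | set r W ih =>
    have h := ih hM.2 hp hMB
    simp only [subst, maxBox, weight, paths_set]
    omega
  | mod m M _ =>
    have hweight := weight_le hM hp
    rw [paths_mod, List.forall_mem_map] at hp
    have hp' : ∀ p ∈ M.paths k, p = [] :=
      fun p h => List.eq_nil_of_length_eq_zero (Nat.succ_injective (hp p h))
    by_cases hb : m = .bang ∧ [] ∈ M.paths k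
    · obtain ⟨rfl, hk⟩ := hb
      exact (maxBox_add_weight_subst_box_le w hV hM hp' hk hMB hVB).trans (by omega)
    · have hmax := maxBox_subst_le (l := δ + 1) (k := k) w hV hM fun p h => by
        obtain ⟨q, hq, rfl⟩ := List.mem_map.1 (paths_mod k M m ▸ h)
        obtain rfl := hp' q hq
        simpa using fun hm => hb ⟨hm.symm, hq⟩
      have := (le_max_right _ _).trans hVB
      omega
  | regc | unit | int | get => simp [subst, maxBox, weight]

end Tm

section machine

/-- The level of the term that `E` surrounds: the number of modal constructors that have been
entered and not yet left. -/
def Env.level : Env → ℕ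
  | [] => 0
  | .mod _ :: E => level E + 1
  | _ :: E => level E

/-- `Tm.Stratified` for the terms in the environment, and no frame `! ·`. -/
def Env.Stratified (L : Region → ℕ) : Env → Prop
  | [] => True
  | .arg V :: E => V.Stratified L (level E) ∧ Stratified L E
  | .fn M :: E => M.Stratified L (level E) ∧ Stratified L E
  | .mod m :: E => m = .para ∧ Stratified L E

/-- The weight of an environment, including the price of the steps that its frames still cause. -/
noncomputable def Env.weight (w : Weights) : Env → ℕ
  | [] => 0
  | .arg V :: E => V.weight w (level E) 0 + w.node (level E) + weight w E
  | .fn M :: E => M.weight w (level E) 0 + 2 * w.node (level E) + weight w E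
  | .mod _ :: E => w.node (level E) + weight w E

/-- The maximum of `Tm.maxBox` over the terms in an environment. -/
noncomputable def Env.maxBox (w : Weights) : Env → ℕ
  | [] => 0
  | .arg V :: E => max (V.maxBox w (level E) 0) (maxBox w E)
  | .fn M :: E => max (M.maxBox w (level E) 0) (maxBox w E)
  | .mod _ :: E => maxBox w E

/-- The weight of a store, in which the value of the region `r` has level `L r`. -/
noncomputable def Store.weight (w : Weights) (L : Region → ℕ) (S : Store) : ℕ :=
  (S.map fun e => e.2.weight w (L e.1) 0).sum

/-- The maximum of `Tm.maxBox` over the values in a store. -/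
noncomputable def Store.maxBox (w : Weights) (L : Region → ℕ) (S : Store) : ℕ :=
  (S.map fun e => e.2.maxBox w (L e.1) 0).sup

namespace Conf

/-- `Tm.Stratified` for all the terms in a configuration. -/
structure Stratified (L : Region → ℕ) (C : Conf) : Prop where
  term : C.term.Stratified L C.env.level
  env : C.env.Stratified L
  store : ∀ e ∈ C.store, e.2.Stratified L (L e.1)

/-- The weight of a configuration, an upper bound for the number of steps that it can make. -/
noncomputable def weight (w : Weights) (L : Region → ℕ) (C : Conf) : ℕ :=
  C.term.weight w C.env.level 0 + C.env.weight w + C.store.weight w L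

/-- The maximum of `Tm.maxBox` over the terms in a configuration. -/
noncomputable def maxBox (w : Weights) (L : Region → ℕ) (C : Conf) : ℕ :=
  max (C.term.maxBox w C.env.level 0) (max (C.env.maxBox w) (C.store.maxBox w L))

end Conf

variable {L : Region → ℕ}

theorem Step.stratified {C C' : Conf} (hs : Step C C') (h : C.Stratified L) : C'.Stratified L := by
  obtain ⟨ht, he, hS⟩ := h
  cases hs with
  | arith => exact ⟨trivial, he, hS⟩
  | beta M V E S hV =>
    refine ⟨Tm.Stratified.subst (k := 0) hV he.1 ht.2 fun p hp => ?_, he.2, hS⟩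
    obtain rfl := List.mem_singleton.1 (ht.1.subset hp)
    exact ⟨rfl, nofun⟩
  | app => exact ⟨ht.2, ⟨ht.1, he⟩, hS⟩
  | swap => exact ⟨he.1, ⟨ht, he.2⟩, hS⟩
  | enter m M E S hM =>
    cases m with
    | para => exact ⟨ht, ⟨rfl, he⟩, hS⟩
    | bang => exact absurd ht.1 hM
  | leave m V =>
    obtain ⟨rfl, he⟩ := he
    exact ⟨ht, he, hS⟩
  | lett m V M E S hV =>
    obtain ⟨hM, hVs, hMs⟩ := ht
    cases m with
    | para =>
      refine ⟨Tm.Stratified.subst (l := E.level + 1) (k := 0) hV hVs hMs fun p hp => ?_, he, hS⟩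
      obtain rfl := List.mem_singleton.1 (hM.subset hp)
      exact ⟨rfl, by simp⟩
    | bang =>
      exact ⟨Tm.Stratified.subst (k := 0) hV hVs.2.2 hMs fun p hp =>
        ⟨congrArg _ (hM p hp), fun _ => hVs.2.1⟩, he, hS⟩
  | get r V E S =>
    obtain ⟨hV, hS⟩ := Multiset.forall_mem_cons.1 hS
    exact ⟨(show L r = E.level from ht) ▸ hV, he, hS⟩
  | set r V E S _ =>
    exact ⟨trivial, he, Multiset.forall_mem_cons.2 ⟨ht.1.symm ▸ ht.2, hS⟩⟩

theorem Store.weight_cons (w : Weights) (r : Region) (V : Tm) (S : Store) :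
    Store.weight w L ((r, V) ::ₘ S) = V.weight w (L r) 0 + S.weight w L := by
  simp [Store.weight]

theorem Store.maxBox_cons (w : Weights) (r : Region) (V : Tm) (S : Store) :
    Store.maxBox w L ((r, V) ::ₘ S) = max (V.maxBox w (L r) 0) (S.maxBox w L) := by
  simp [Store.maxBox]

variable {w : Weights} {Z : ℕ}

theorem Tm.weight_inst_le_and_maxBox_inst_le {δ l : ℕ} {M V : Tm} (w : Weights)
    (hV : V.IsValue) (hM : M.Stratified L δ) (hlen : (M.paths 0).length ≤ 1)
    (hp : ∀ p ∈ M.paths 0, δ + p.length = l ∧ .bang ∉ p) :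
    (M.inst V).weight w δ 0 ≤ M.weight w δ 1 + V.weight w l 0 ∧
      (M.inst V).maxBox w δ 0 ≤ max (M.maxBox w δ 1) (V.maxBox w l 0) :=
  ⟨weight_subst_le_of_length_paths_le_one w hV hM (fun p h => (hp p h).1) hlen,
    maxBox_subst_le (k := 0) w hV hM hp⟩

theorem Tm.weight_inst_lt_and_maxBox_add_weight_inst_le {δ B : ℕ} {m : Modality} {M V : Tm}
    (hV : V.IsValue) (h : (lett m (mod m V) M).Stratified L δ)
    (hB : (lett m (mod m V) M).maxBox w δ 0 ≤ B) (hnode : B < w.box δ * w.node δ) :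
    (M.inst V).weight w δ 0 < (lett m (mod m V) M).weight w δ 0 ∧
      (M.inst V).maxBox w δ 0 + (M.inst V).weight w δ 0 ≤
        B + (lett m (mod m V) M).weight w δ 0 := by
  obtain ⟨hM, hVs, hMs⟩ := h
  have hpos : 0 < w.node δ := Nat.pos_of_mul_pos_left (Nat.zero_lt_of_lt hnode)
  rw [maxBox, max_le_iff] at hB
  simp only [weight, add_mul, one_mul]
  cases m with
  | para =>
    obtain ⟨hweight, hmax⟩ := weight_inst_le_and_maxBox_inst_le (l := δ + 1) w hV hMs hM.length_le
      fun p hp => by rw [List.mem_singleton.1 (hM.subset hp)]; exact ⟨rfl, by simp⟩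
    simp only [weight, maxBox, if_pos hV, zero_add] at *
    omega
  | bang =>
    have hcontent : V.weight w (δ + 1) 0 < w.node δ :=
      Nat.lt_of_mul_lt_mul_left <| ((le_max_left _ _).trans hB.1).trans_lt hnode
    have hcopies := Nat.mul_le_mul_left (M.paths 0).length hcontent.le
    have hweight := weight_subst_le w hV hMs fun p h => congrArg (δ + ·) (hM p h)
    have hpotential := maxBox_add_weight_subst_le w hV hMs hM hB.2 hB.1
    simp only [inst, singleAt] at *
    omega

theorem Step.weight_lt_and_maxBox_add_weight_le {C C' : Conf} (hs : Step C C')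
    (hnode : ∀ i, 0 < w.node i) (hZ : ∀ i, Z ≤ w.box i * w.node i) (h : C.Stratified L)
    (hCZ : C.maxBox w L + C.weight w L ≤ Z) :
    C'.weight w L < C.weight w L ∧
      C'.maxBox w L + C'.weight w L ≤ C.maxBox w L + C.weight w L := by
  obtain ⟨ht, he, -⟩ := h
  have hlevel := hnode C.env.level
  cases hs with
  | arith | app | swap =>
    simp only [Conf.weight, Conf.maxBox, Tm.weight, Tm.maxBox, Env.weight, Env.maxBox,
      Env.level] at *
    omega
  | beta M V E S hV =>
    obtain ⟨hweight, hmax⟩ := Tm.weight_inst_le_and_maxBox_inst_le (l := E.level) w hV ht.2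
      ht.1.length_le fun p hp => by rw [List.mem_singleton.1 (ht.1.subset hp)]; exact ⟨rfl, nofun⟩
    simp only [Conf.weight, Conf.maxBox, Tm.weight, Tm.maxBox, Env.weight, Env.maxBox,
      Env.level, zero_add] at *
    omega
  | enter m M E S hM =>
    cases m with
    | para =>
      simp only [Conf.weight, Conf.maxBox, Tm.weight, Tm.maxBox, Env.weight, Env.maxBox,
        Env.level, if_neg hM] at *
      omega
    | bang => exact absurd ht.1 hM
  | leave m V E S hV =>
    obtain ⟨rfl, -⟩ := he
    simp only [Conf.weight, Conf.maxBox, Tm.weight, Tm.maxBox, Env.weight, Env.maxBox, Env.level,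
      if_pos hV]
    have := hnode E.level
    omega
  | lett m V M E S hV =>
    have hpos : 0 < (Conf.mk (.lett m (.mod m V) M) E S).weight w L := by
      simp only [Conf.weight, Tm.weight, add_mul, one_mul] at *
      omega
    have hlt := ((Nat.lt_add_of_pos_right hpos).trans_le hCZ).trans_le (hZ E.level)
    have hinst := Tm.weight_inst_lt_and_maxBox_add_weight_inst_le hV ht (le_max_left _ _) hlt
    simp only [Conf.weight, Conf.maxBox] at *
    omega
  | get r V E S =>
    have hL : L r = E.level := ht
    simp only [Conf.weight, Conf.maxBox, Tm.weight, Tm.maxBox, Store.weight_cons,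
      Store.maxBox_cons, hL] at *
    omega
  | set r V E S _ =>
    have hL : L r = E.level := ht.1
    simp only [Conf.weight, Conf.maxBox, Tm.weight, Tm.maxBox, Store.weight_cons,
      Store.maxBox_cons, hL] at *
    omega

theorem Steps.add_weight_le {n : ℕ} {C C' : Conf} (hs : Steps n C C')
    (hnode : ∀ i, 0 < w.node i) (hZ : ∀ i, Z ≤ w.box i * w.node i) (h : C.Stratified L)
    (hCZ : C.maxBox w L + C.weight w L ≤ Z) : n + C'.weight w L ≤ C.weight w L := by
  induction hs with
  | refl C => exact (Nat.zero_add _).le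
  | head hs _ ih =>
    obtain ⟨hlt, hle⟩ := hs.weight_lt_and_maxBox_add_weight_le hnode hZ h hCZ
    have := ih (hs.stratified h) (hle.trans hCZ)
    omega

theorem terminatesWithin_of_forall_le {C : Conf} {N : ℕ}
    (h : ∀ (n : ℕ) (C' : Conf), Steps n C C' → n ≤ N) : TerminatesWithin C N := by
  refine ⟨h, ?_⟩
  induction N generalizing C with
  | zero => exact ⟨0, C, .refl C, fun C' hs => by simpa using h _ _ (.head hs (.refl C'))⟩
  | succ N ih =>
    by_cases hC : C.IsFinal
    · exact ⟨0, C, .refl C, hC⟩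
    · simp only [Conf.IsFinal, not_forall, not_not] at hC
      obtain ⟨C₁, hs⟩ := hC
      obtain ⟨n, C', hn, hfin⟩ := ih fun n C' hn =>
        Nat.le_of_succ_le_succ (h _ _ (.head hs hn))
      exact ⟨n + 1, C', .head hs hn, hfin⟩

end machine

section bounds

variable {w : Weights} {L : Region → ℕ} {d : ℕ}

theorem Weights.box_mul_le {δ n x : ℕ} (hbox : w.box δ * w.node (δ + 1) ≤ w.node δ)
    (hx : x ≤ n * w.node (δ + 1)) : w.box δ * x ≤ n * w.node δ :=
  calc w.box δ * x ≤ w.box δ * (n * w.node (δ + 1)) := Nat.mul_le_mul_left _ hx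
    _ = n * (w.box δ * w.node (δ + 1)) := Nat.mul_left_comm _ _ _
    _ ≤ n * w.node δ := Nat.mul_le_mul_left _ hbox

-- The summand `occs.length * N` pays for the copies made by the `let` that binds the occurrences.
theorem Tm.weight_add_length_occs_mul_le (hnode : Antitone w.node)
    (hbox : ∀ i < d, w.box i * w.node (i + 1) ≤ w.node i) {δ : ℕ} {M : Tm}
    (hM : M.Stratified L δ) (hd : δ + M.depth ≤ d) {N : ℕ} (hN : w.node δ ≤ N) (k : ℕ) :
    M.weight w δ k + M.occs.length * N ≤ 3 * M.size * N := by
  induction M generalizing δ N k with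
  | lam M ih =>
    have h := ih hM.2 hd hN (k + 1)
    rw [length_occs_eq, add_mul] at h
    simp only [weight, occs, size, mul_add, add_mul]
    omega
  | app M M' ih₁ ih₂ | arith _ M M' ih₁ ih₂ =>
    simp only [depth] at hd
    have h₁ := ih₁ hM.1 (by omega) hN k
    have h₂ := ih₂ hM.2 (by omega) hN k
    simp only [weight, occs, List.length_append, size, mul_add, add_mul]
    omega
  | lett m V M ih₁ ih₂ =>
    simp only [depth] at hd
    have h₁ := ih₁ hM.2.1 (by omega) hN k
    have h₂ := ih₂ hM.2.2 (by omega) hN (k + 1)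
    rw [length_occs_eq, add_mul] at h₂
    have h₃ := Nat.mul_le_mul_left (1 + (M.paths 0).length) hN
    rw [add_mul _ _ N] at h₃
    simp only [weight, occs, List.length_append, size, mul_add, add_mul] at *
    omega
  | mod m M ih =>
    simp only [depth, ← add_assoc, add_right_comm] at hd
    cases m with
    | para =>
      have h := ih (δ := δ + 1) hM hd ((hnode δ.le_succ).trans hN) k
      simp only [weight, occs, List.length_map, size, mul_add, add_mul]
      split_ifs <;> omega
    | bang =>
      have hocc := Nat.mul_le_mul_right N hM.2.1
      have hcontent := Weights.box_mul_le (hbox δ (by omega)) <|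
        (Nat.le_add_right _ _).trans (ih hM.2.2 hd le_rfl k)
      have hsize := Nat.mul_le_mul_left (3 * M.size) hN
      simp only [weight, occs, List.length_map, size, mul_add, add_mul]
      split_ifs <;> omega
  | set r V ih =>
    have h := ih hM.2 hd hN k
    simp only [weight, occs, size, mul_add, add_mul]
    omega
  | var | regc | unit | int | get =>
    simp only [weight, occs, size, List.length_nil, List.length_singleton]
    omega

theorem Tm.maxBox_le (hnode : Antitone w.node)
    (hbox : ∀ i < d, w.box i * w.node (i + 1) ≤ w.node i) {δ : ℕ} {M : Tm}
    (hM : M.Stratified L δ) (hd : δ + M.depth ≤ d) (k : ℕ) :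
    M.maxBox w δ k ≤ 3 * M.size * w.node δ := by
  induction M generalizing δ k with
  | lam M ih =>
    exact (ih hM.2 hd (k + 1)).trans <| Nat.mul_le_mul_right _ <|
      Nat.mul_le_mul_left 3 M.size.le_succ
  | app M M' ih₁ ih₂ | arith _ M M' ih₁ ih₂ =>
    simp only [depth] at hd
    have h₁ := ih₁ hM.1 (by omega) k
    have h₂ := ih₂ hM.2 (by omega) k
    simp only [maxBox, size, mul_add, add_mul]
    omega
  | lett m V M ih₁ ih₂ =>
    simp only [depth] at hd
    have h₁ := ih₁ hM.2.1 (by omega) k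
    have h₂ := ih₂ hM.2.2 (by omega) (k + 1)
    simp only [maxBox, size, mul_add, add_mul]
    omega
  | mod m M ih =>
    simp only [depth, ← add_assoc, add_right_comm] at hd
    have hsucc : 3 * M.size * w.node (δ + 1) ≤ 3 * M.size * w.node δ :=
      Nat.mul_le_mul_left _ (hnode δ.le_succ)
    cases m with
    | para =>
      have h := ih (δ := δ + 1) hM hd k
      simp only [maxBox, size, mul_add, add_mul]
      omega
    | bang =>
      have h := ih hM.2.2 hd k
      have hweight := (Nat.le_add_right _ _).trans <|
        weight_add_length_occs_mul_le hnode hbox hM.2.2 hd le_rfl k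
      have hcontent := Weights.box_mul_le (hbox δ (by omega)) hweight
      simp only [maxBox, size, mul_add, add_mul]
      omega
  | set r V ih =>
    exact (ih hM.2 hd k).trans <| Nat.mul_le_mul_right _ <|
      Nat.mul_le_mul_left 3 V.size.le_succ
  | var | regc | unit | int | get => exact Nat.zero_le _

/-- Weights for terms of depth at most `d`. In `box i * node (i + 1) = node i` for `i < d`, the
exponents `2 ^ i` must double from one level to the next for `box i * node i` not to depend on `i`.
The exponent of `node i` is truncated for `d < i`. -/
def Weights.ofDepth (a d : ℕ) : Weights where
  node i := a ^ (2 ^ d - 2 ^ i)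
  box i := a ^ 2 ^ i

namespace Weights

theorem antitone_node_ofDepth {a : ℕ} (ha : 0 < a) (d : ℕ) : Antitone (ofDepth a d).node :=
  fun _ _ hij => Nat.pow_le_pow_right ha
    (Nat.sub_le_sub_left (Nat.pow_le_pow_right two_pos hij) _)

theorem pow_le_box_mul_node_ofDepth {a : ℕ} (ha : 0 < a) (d i : ℕ) :
    a ^ 2 ^ d ≤ (ofDepth a d).box i * (ofDepth a d).node i := by
  rw [ofDepth, ← pow_add]
  exact Nat.pow_le_pow_right ha (by omega)

theorem box_mul_node_succ_ofDepth (a : ℕ) {d i : ℕ} (hi : i < d) :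
    (ofDepth a d).box i * (ofDepth a d).node (i + 1) = (ofDepth a d).node i := by
  have := Nat.pow_le_pow_right two_pos (Nat.succ_le_of_lt hi)
  rw [ofDepth, ← pow_add]
  congr 1
  rw [Nat.succ_eq_add_one, pow_succ] at this
  rw [pow_succ]
  omega

theorem mul_node_zero_ofDepth (a d : ℕ) : a * (ofDepth a d).node 0 = a ^ 2 ^ d := by
  rw [ofDepth, ← pow_succ', pow_zero, Nat.sub_add_cancel Nat.one_le_two_pow]

end Weights

theorem Tm.Stratified.terminatesWithin_init {M : Tm} (hM : M.Stratified L 0) :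
    TerminatesWithin (Conf.init M) ((6 * M.size) ^ 2 ^ M.depth) := by
  let w := Weights.ofDepth (6 * M.size) M.depth
  have hs : 0 < 6 * M.size := Nat.mul_pos (by decide) M.size_pos
  have hnode : Antitone w.node := Weights.antitone_node_ofDepth hs _
  have hbox (i) (hi : i < M.depth) : w.box i * w.node (i + 1) ≤ w.node i :=
    (Weights.box_mul_node_succ_ofDepth _ hi).le
  have hweight := (Nat.le_add_right _ _).trans <|
    M.weight_add_length_occs_mul_le hnode hbox hM (Nat.zero_add _).le le_rfl 0
  have hmaxBox := M.maxBox_le hnode hbox hM (Nat.zero_add _).le 0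
  have hpotential : (Conf.init M).maxBox w L + (Conf.init M).weight w L ≤
      (6 * M.size) ^ 2 ^ M.depth :=
    calc (Conf.init M).maxBox w L + (Conf.init M).weight w L
        = M.maxBox w 0 0 + M.weight w 0 0 := by
          simp [Conf.maxBox, Conf.weight, Conf.init, Env.level, Env.weight, Env.maxBox,
            Store.weight, Store.maxBox]
      _ ≤ 3 * M.size * w.node 0 + 3 * M.size * w.node 0 := Nat.add_le_add hmaxBox hweight
      _ = 6 * M.size * w.node 0 := by ring
      _ = (6 * M.size) ^ 2 ^ M.depth := Weights.mul_node_zero_ofDepth _ _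
  have hstratified : (Conf.init M).Stratified L := ⟨hM, trivial, nofun⟩
  refine terminatesWithin_of_forall_le fun n C hn => ?_
  have hlen := hn.add_weight_le (fun i => pow_pos hs _)
    (Weights.pow_le_box_mul_node_ofDepth hs _) hstratified hpotential
  exact ((Nat.le_add_right _ _).trans hlen).trans ((Nat.le_add_left _ _).trans hpotential)

end bounds

section typing

/-- `Γ` permits occurrences of the variables at the paths `ps`: they are allowed by the usages in
`Γ`, and undeclared variables do not occur. -/
def Ctx.Permits (Γ : Ctx) (ps : ℕ → List (List Modality)) : Prop :=
  ∀ x, match Γ x with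
    | none => ps x = []
    | some (u, _) => u.Allows (ps x)

/-- The level of the region `r` in a term typed at depth `δ₀`. Typing depths decrease under modal
constructors, whereas levels increase from `0`. -/
def RegCtx.level (R : RegCtx) (δ₀ : ℕ) (r : Region) : ℕ := δ₀ - ((R r).map Prod.fst).getD 0

theorem Usage.allows_nil (u : Usage) : u.Allows [] := by
  match u with
  | .lam | .mod .para => exact List.nil_sublist _
  | .mod .bang => exact nofun

theorem Usage.allows_bang_map_cons {ps : List (List Modality)} (h : Usage.lam.Allows ps)
    (m : Modality) : (Usage.mod .bang).Allows (ps.map (m :: ·)) :=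
  List.forall_mem_map.2 fun p hp => by rw [List.mem_singleton.1 (h.subset hp)]; rfl

theorem Tm.paths_rename_contractRen {x y z v : ℕ} (hxy : ¬ (v = x ∨ v = y)) (hz : v ≠ z)
    (M : Tm) : (M.rename (contractRen x y z)).paths v = M.paths v := by
  refine paths_rename (fun i => ?_) M
  unfold contractRen
  split_ifs with hi
  · exact iff_of_false hz.symm fun h => hxy (h ▸ hi)
  · rfl

namespace Ctx

theorem permits_cons {Γ : Ctx} {u : Usage} {A : Ty} {ps : ℕ → List (List Modality)} :
    (Γ.cons u A).Permits ps ↔ u.Allows (ps 0) ∧ Γ.Permits fun x => ps (x + 1) :=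
  ⟨fun h => ⟨h 0, fun x => h (x + 1)⟩, fun h x => match x with
    | 0 => h.1
    | x + 1 => h.2 x⟩

variable {Γ Δ : Ctx}

theorem Permits.union {ps qs : ℕ → List (List Modality)} (hΓ : Γ.Permits ps) (hΔ : Δ.Permits qs)
    (hd : Γ.Disjoint Δ) : (Γ.union Δ).Permits fun x => ps x ++ qs x := fun x => by
  have hps := hΓ x
  have hqs := hΔ x
  rcases hd x with h | h
  · rw [h] at hps
    simpa [Ctx.union, h, show ps x = [] from hps] using hqs
  · rw [h] at hqs
    simpa [Ctx.union, h, show qs x = [] from hqs] using hps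

theorem Permits.insert {ps : ℕ → List (List Modality)} (hΓ : Γ.Permits ps) {x : ℕ}
    (hx : Γ x = none) (u : Usage) (A : Ty) : (Γ.insert x u A).Permits ps := fun y => by
  have h := hΓ y
  obtain rfl | hy := eq_or_ne y x
  · rw [hx] at h
    simpa [Ctx.insert, show ps y = [] from h] using u.allows_nil
  · rwa [Ctx.insert, Function.update_of_ne hy]

theorem Permits.contract {M : Tm} {A : Ty} {x y z : ℕ} (hx : Γ x = none) (hy : Γ y = none)
    (hz : Γ z = none) (hxy : x ≠ y)
    (h : ((Γ.insert x (.mod .bang) A).insert y (.mod .bang) A).Permits fun i => M.paths i) :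
    (Γ.insert z (.mod .bang) A).Permits fun i => (M.rename (contractRen x y z)).paths i := by
  intro v
  obtain rfl | hv := eq_or_ne v z
  · simp only [Ctx.insert, Function.update_self]
    intro p hpv
    obtain ⟨i, hi, hp⟩ := Tm.mem_paths_rename.1 hpv
    have hpi := h i
    by_cases hixy : i = x ∨ i = y
    · have hbang : (Γ.insert x (.mod .bang) A).insert y (.mod .bang) A i =
          some (.mod .bang, A) := by
        rcases hixy with rfl | rfl <;> simp [Ctx.insert, hxy]
      rw [hbang] at hpi
      exact hpi p hp
    · rw [contractRen, if_neg hixy] at hi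
      obtain rfl := hi
      obtain ⟨hix, hiy⟩ := not_or.1 hixy
      rw [Ctx.insert, Ctx.insert, Function.update_of_ne hiy, Function.update_of_ne hix, hz] at hpi
      rw [show M.paths i = [] from hpi] at hp
      exact absurd hp List.not_mem_nil
  · simp only [Ctx.insert, Function.update_of_ne hv]
    by_cases hvxy : v = x ∨ v = y
    · have hΓ : Γ v = none := by rcases hvxy with rfl | rfl <;> assumption
      rw [hΓ]
      refine List.eq_nil_iff_forall_not_mem.2 fun p hp => ?_
      obtain ⟨i, hi, -⟩ := Tm.mem_paths_rename.1 hp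
      unfold contractRen at hi
      split_ifs at hi with hixy
      · exact hv hi.symm
      · exact hixy (hi ▸ hvxy)
    · rw [Tm.paths_rename_contractRen hvxy hv]
      obtain ⟨hvx, hvy⟩ := not_or.1 hvxy
      simpa [Ctx.insert, hvx, hvy] using h v

theorem Permits.promote {ps : ℕ → List (List Modality)} (hΓ : Γ.Permits ps) (h : Γ.Promotes Δ) :
    Δ.Permits fun x => (ps x).map (.para :: ·) := fun x => by
  have hps := hΓ x
  rcases h x with ⟨h, h'⟩ | ⟨A, m, h, h'⟩ <;> rw [h] at hps <;> rw [h']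
  · exact congrArg _ hps
  · cases m with
    | para => exact List.Sublist.map _ hps
    | bang => exact Usage.allows_bang_map_cons hps .para

theorem Permits.promote_insert {ps : ℕ → List (List Modality)} {x : ℕ} {A : Ty}
    (h : (Ctx.empty.insert x .lam A).Permits ps) :
    (Ctx.empty.insert x (.mod .bang) A).Permits fun y => (ps y).map (.bang :: ·) := fun y => by
  have hy := h y
  obtain rfl | hyx := eq_or_ne y x
  · simp only [Ctx.insert, Function.update_self] at hy ⊢
    exact Usage.allows_bang_map_cons hy .bang
  · simp only [Ctx.insert, Function.update_of_ne hyx] at hy ⊢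
    exact congrArg _ hy

theorem Permits.length_occs_le_one {M : Tm} {x : ℕ} {A : Ty}
    (h : (Ctx.empty.insert x .lam A).Permits fun y => M.paths y) : M.occs.length ≤ 1 := by
  have hocc : ∀ o ∈ M.occs, o.2 = x := fun o ho => by
    by_contra ho'
    have hnil := h o.2
    simp only [Ctx.insert, Function.update_of_ne ho'] at hnil
    simpa [show M.paths o.2 = [] from hnil] using Tm.mem_paths.2 ho
  have hx := h x
  simp only [Ctx.insert, Function.update_self] at hx
  have hlen := List.Sublist.length_le hx
  rwa [Tm.paths, List.length_map, List.filter_eq_self.2 (by simpa using hocc)] at hlen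

end Ctx

variable {R : RegCtx} {Γ : Ctx} {δ : ℕ} {M : Tm} {A : Ty}

theorem HasType.permits (h : HasType R Γ δ M A) : Γ.Permits fun x => M.paths x := by
  induction h with
  | int | unit | regc | get => exact fun _ => rfl
  | var _ x =>
    intro y
    obtain rfl | hy := eq_or_ne y x
    · simp only [Ctx.insert, Function.update_self, Tm.paths_var, if_true]
      exact List.Sublist.refl _
    · simp [Ctx.insert, hy, hy.symm, Ctx.empty]
  | arith _ hd _ _ _ _ ih₁ ih₂ | app hd _ _ ih₁ ih₂ => simpa using ih₁.union ih₂ hd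
  | contr hx hy hz hxy _ ih => exact ih.contract hx hy hz hxy
  | weak hx _ _ ih => exact ih.insert hx _ _
  | lam _ ih => simpa using (Ctx.permits_cons.1 ih).2
  | bangProm _ _ ih => simpa using ih.promote_insert
  | bangPromClosed _ _ ih => exact fun x => by simpa [Ctx.empty] using ih x
  | paraProm h _ ih => simpa using ih.promote h
  | lett m hd _ _ _ ih₁ ih₂ => simpa using ih₁.union (Ctx.permits_cons.1 ih₂).2 hd
  | set _ _ _ _ ih => exact ih
  | unfold _ ih | fold _ ih => exact ih

theorem HasType.stratified (h : HasType R Γ δ M A) (i : ℕ) :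
    M.Stratified (R.level (i + δ)) i := by
  induction h generalizing i with
  | int | unit | var => trivial
  | regc _ hr => simp [Tm.Stratified, RegCtx.level, hr]
  | arith _ _ _ _ _ _ ih₁ ih₂ | app _ _ _ ih₁ ih₂ => exact ⟨ih₁ i, ih₂ i⟩
  | contr _ _ _ _ _ ih => exact (ih i).rename _
  | weak _ _ _ ih => exact ih i
  | lam hM ih => exact ⟨hM.permits 0, ih i⟩
  | @bangProm _ δ _ _ _ hV hM ih =>
    exact ⟨hV, hM.permits.length_occs_le_one, add_right_comm i 1 δ ▸ ih (i + 1)⟩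
  | @bangPromClosed δ _ _ hV hM ih =>
    exact ⟨hV, (hM.permits.insert (x := 0) rfl .lam .unit).length_occs_le_one,
      add_right_comm i 1 δ ▸ ih (i + 1)⟩
  | @paraProm _ _ δ _ _ _ _ ih => exact add_right_comm i 1 δ ▸ ih (i + 1)
  | lett _ _ _ _ hM ih₁ ih₂ => exact ⟨hM.permits 0, ih₁ i, ih₂ i⟩
  | get _ ih => exact ih i
  | set _ _ _ ih₁ ih₂ => exact ⟨ih₁ i, ih₂ i⟩
  | unfold _ ih | fold _ ih => exact ih i

end typing
end LALReg

theorem theorem1_general {R : LALReg.RegCtx} {Γ : LALReg.Ctx} {δ : ℕ} {M : LALReg.Tm}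
    {A : LALReg.Ty} (hM : LALReg.HasType R Γ δ M A) :
    LALReg.TerminatesWithin (LALReg.Conf.init M) ((6 * M.size) ^ 2 ^ M.depth) :=
  (hM.stratified 0).terminatesWithin_init

theorem theorem1 :
    ∃ P : ℕ → Polynomial ℕ, ∀ M : LALReg.Tm, LALReg.WellTyped M →
      LALReg.TerminatesWithin (LALReg.Conf.init M) ((P M.depth).eval M.size) :=
  ⟨fun d => (6 * Polynomial.X) ^ 2 ^ d, fun M ⟨_, _, _, _, _, hM, _⟩ => by
    simpa using theorem1_general hM⟩
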